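/- \textbf{Theorem.} Let $(\Omega,\mu)$ be an atomless standard probability space and let $W:\Omega^2\to[0,1]$ be a graphon, i.e. a symmetric measurable function, with degree function $\deg_W(x)=\int_\Omega W(x,y)\,d\mu(y)$. For a simple graph $G$ on $n\ge 1$ vertices, let $W_G$ be a graphon representation of $G$: partition $\Omega=\bigsqcup_{v\in V(G)}\Omega_v$ into measurable sets of measure $1/n$ and let $W_G$ be $1$ on $\Omega_u\times\Omega_v$ for each edge $uv$ of $G$, and $0$ elsewhere. Let $$\delta_\square(W,G)=\inf_{\varphi}\ \sup_{S,T\subseteq\Omega}\left|\int_{S}\int_{T}\bigl(W(\varphi(x),\varphi(y))-W_G(x,y)\bigr)\,d\mu(y)\,d\mu(x)\right|,$$ where $\varphi$ ranges over the measure preserving automorphisms of $\Omega$ and $S,T$ over the measurable sets; this does not depend on the choice of the representation $W_G$. Let $\delta>0$, and let $G_1,G_2,\ldots$ be simple graphs such that $G_n$ has $n$ vertices, for all sufficiently large $n$ the graph $G_n$ is connected and has minimum degree at least $\delta n$, and $G_n$ converges to $W$, i.e. $\delta_\square(W,G_n)\to0$. Then $\deg_W>0$ almost everywhere, $\log\deg_W$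 is integrable, and the number $t(G_n)$ of spanning trees of $G_n$ satisfies $$\lim_{n\to\infty}\frac{t(G_n)^{1/n}}{n}=\exp\left(\int_\Omega\log\bigl(\deg_W(x)\bigr)\,d\mu(x)\right).$$ -/

import Mathlib

open MeasureTheory Filter Topology
open scoped ENNReal

/-- A graphon on the probability space `(Ω, μ)`: a symmetric function `Ω² → [0,1]` that is measurable
with respect to the completion of the product measure (Lebesgue measurable). -/
structure Graphon {Ω : Type*} [MeasurableSpace Ω] (μ : Measure Ω) where
  toFun : Ω → Ω → ℝ
  symm : ∀ x y, toFun x y = toFun y x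
  nonneg : ∀ x y, 0 ≤ toFun x y
  le_one : ∀ x y, toFun x y ≤ 1
  aemeasurable : AEMeasurable (fun p : Ω × Ω => toFun p.1 p.2) (μ.prod μ)

namespace Graphon

variable {Ω : Type*} [MeasurableSpace Ω] {μ : Measure Ω}

/-- The degree `deg_W(x) = ∫ W(x,y) dy`. -/
noncomputable def deg (W : Graphon μ) (x : Ω) : ℝ :=
  ∫ y, W.toFun x y ∂μ

/-- The cut-norm `sup_{S,T} |∫_{x∈S} ∫_{y∈T} U(x,y)|`, with `S, T` ranging over the measurable sets. -/
noncomputable def cutNorm (μ : Measure Ω) (U : Ω → Ω → ℝ) : ℝ≥0∞ :=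
  ⨆ (S : Set Ω) (_ : MeasurableSet S) (T : Set Ω) (_ : MeasurableSet T),
    ENNReal.ofReal |∫ x in S, ∫ y in T, U x y ∂μ ∂μ|

/-- The cut-distance `inf_φ ‖W₁^φ - W₂‖_□`, with `φ` ranging over the measure preserving
automorphisms of `Ω`. -/
noncomputable def cutDist (W₁ W₂ : Graphon μ) : ℝ≥0∞ :=
  ⨅ (φ : Ω ≃ᵐ Ω) (_ : MeasurePreserving φ μ μ),
    cutNorm μ (fun x y => W₁.toFun (φ x) (φ y) - W₂.toFun x y)

/-- A measurable partition of `Ω` into `n` labelled cells of measure `1/n`; the cell of label `v`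
is the set of all `x` with `cell x = v`. -/
structure EquiPartition (μ : Measure Ω) (n : ℕ) where
  cell : Ω → Fin n
  measurable_cell : Measurable cell
  measure_cell : ∀ v, μ (cell ⁻¹' {v}) = (n : ℝ≥0∞)⁻¹

open Classical in
/-- The graphon representation `W_G` of a graph `G` given by a partition `Ω = ⨆ Ω_v`: it is `1` on
`Ω_u × Ω_v` for each edge `uv`, and `0` otherwise. -/
noncomputable def ofGraph {n : ℕ} (P : EquiPartition μ n) (G : SimpleGraph (Fin n)) : Graphon μ where
  toFun x y := if G.Adj (P.cell x) (P.cell y) then 1 else 0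
  symm x y := by simp only [G.adj_comm]
  nonneg x y := by split_ifs <;> norm_num
  le_one x y := by split_ifs <;> norm_num
  aemeasurable := by
    have h : Measurable (fun q : Fin n × Fin n => if G.Adj q.1 q.2 then (1 : ℝ) else 0) :=
      measurable_of_countable _
    exact (h.comp ((P.measurable_cell.comp measurable_fst).prodMk
      (P.measurable_cell.comp measurable_snd))).aemeasurable

/-- The cut-distance `δ_□(W, G) = δ_□(W, W_G)`. On an atomless standard probability space it does not
depend on the representation `W_G`, so the infimum over all representations is their common value. -/
noncomputable def cutDistGraph {n : ℕ} (W : Graphon μ) (G : SimpleGraph (Fin n)) : ℝ≥0∞ :=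
  ⨅ P : EquiPartition μ n, cutDist W (ofGraph P G)

/-- Convergence of a sequence of graphs, the `n`-th one of order `n`, to the graphon `W`. -/
def GraphsConvergeTo (G : (n : ℕ) → SimpleGraph (Fin n)) (W : Graphon μ) : Prop :=
  Tendsto (fun n => cutDistGraph W (G n)) atTop (𝓝 0)

end Graphon

/-- The number `t(G)` of spanning trees of `G`. -/
noncomputable def numSpanningTrees {V : Type*} (G : SimpleGraph V) : ℕ :=
  Nat.card {T : SimpleGraph V // T ≤ G ∧ T.IsTree}

/-!
The degrees determine the number of spanning trees of a dense connected graph up to a subexponential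
factor, and the empirical distribution of the normalized degrees converges to that of `deg_W`.

*Counting trees.* Fix a root `r` in a graph `G` on `n` vertices with all degrees at least `δ n`.
Spanning trees correspond to parent maps along edges of `G` under which every vertex reaches `r`, so
`t(G) ≤ ∏_{v ≠ r} deg v` (`SimpleGraph.numSpanningTrees_le_prod_degree`). For the lower bound, the
matrix-tree theorem (`SimpleGraph.det_reducedLaplacian`) gives
`t(G) = ∏_{v ≠ r} deg v * det B`, where `B` is the reduced Laplacian normalized to have diagonal `1`.
The squared Frobenius norm of `B - 1` is at most `1 / δ` and its trace is `0`. The eigenvalues of `B`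
are at least `1 / (2 n ^ 4)`, because `G` is connected. Expanding `log μ = (μ - 1) + O((μ - 1) ^ 2)`
over the eigenvalues, at the cost of a factor `O(log n)` in the error for the boundedly many small
ones, gives `log (det B) ≥ -O(log n)` (`Matrix.IsHermitian.le_log_det`,
`SimpleGraph.Connected.le_log_numSpanningTrees`). Hence
`(log t(G)) / n - log n = (1 / n) ∑ v, log (deg v / n) + O((log n) / n)`.

*Degrees.* The degree function of the representation `W_G` takes the value `deg v / n` on the cell of
`v`, and the cut norm dominates the `L¹`-distance of degree functions up to a factor `2`
(`Graphon.integral_abs_deg_sub_le`). So `deg_W` is, after rearrangement, an `L¹`-limit of functions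
with values in `[δ, 1]`. It follows that `deg_W ≥ δ` almost everywhere, and since `log` is Lipschitz on
`[δ, 1]`, that the averages of `log (deg v / n)` converge to the integral of `log deg_W`
(`Graphon.GraphsConvergeTo.tendsto_average_log_degree`).
-/

/-! ### Spanning trees and parent maps -/

namespace SimpleGraph

open Finset Matrix

variable {V : Type*}

/-- The graph with an edge between `v` and `f v` for each `v` with `f v ≠ v`. -/
def parentGraph (f : V → V) : SimpleGraph V :=
  fromRel fun v w => f v = w

lemma parentGraph_adj {f : V → V} {v w : V} :
    (parentGraph f).Adj v w ↔ v ≠ w ∧ (f v = w ∨ f w = v) := by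
  simp [parentGraph]

/-- `f` is the parent map of a rooted tree on all of `V` with root `r`: every vertex reaches `r` under
iteration of `f`, and the root is, by convention, its own parent. -/
def IsRootedAt (f : V → V) (r : V) : Prop :=
  f r = r ∧ ∀ v, ∃ k, f^[k] v = r

lemma IsRootedAt.ne {f : V → V} {r v : V} (hf : IsRootedAt f r) (hv : v ≠ r) : f v ≠ v := by
  intro h
  obtain ⟨k, hk⟩ := hf.2 v
  exact hv ((Function.iterate_fixed h k).symm.trans hk)

/-- A set closed under the parent map is empty if it avoids the root. -/
lemma IsRootedAt.notMem_of_forall {f : V → V} {r : V} (hf : IsRootedAt f r) {S : V → Prop}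
    (hr : ¬ S r) (hS : ∀ v, S v → S (f v)) (v : V) : ¬ S v := by
  intro hv
  obtain ⟨k, hk⟩ := hf.2 v
  have : ∀ k, S (f^[k] v) := by
    intro k
    induction k with
    | zero => exact hv
    | succ k ih => rw [Function.iterate_succ_apply']; exact hS _ ih
  exact hr (hk ▸ this k)

lemma IsRootedAt.connected {f : V → V} {r : V} (hf : IsRootedAt f r) :
    (parentGraph f).Connected := by
  have key : ∀ v, (parentGraph f).Reachable v r := by
    intro v
    by_contra hv
    refine hf.notMem_of_forall (S := fun v => ¬ (parentGraph f).Reachable v r) (by simp) ?_ v hv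
    intro w hw hfw
    by_cases h : w = f w
    · rw [← h] at hfw
      exact hw hfw
    · exact hw ((parentGraph_adj.2 ⟨h, Or.inl rfl⟩).reachable.trans hfw)
  exact (connected_iff _).2 ⟨fun v w => (key v).trans (key w).symm, ⟨r⟩⟩

lemma IsRootedAt.isTree [Finite V] {f : V → V} {r : V} (hf : IsRootedAt f r) :
    (parentGraph f).IsTree := by
  classical
  have := Fintype.ofFinite V
  rw [isTree_iff_connected_and_card]
  refine ⟨hf.connected, le_antisymm ?_ hf.connected.card_vert_le_card_edgeSet_add_one⟩
  -- every edge joins some `v ≠ r` to its parent, so there are at most `|V| - 1` of them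
  have hsub : (parentGraph f).edgeSet ⊆
      ((univ.erase r).image fun v => s(v, f v) : Finset (Sym2 V)) := by
    intro e
    induction e with
    | _ v w =>
      intro h
      obtain ⟨hne, h⟩ := parentGraph_adj.1 h
      simp only [coe_image, Set.mem_image, mem_coe, mem_erase, mem_univ, and_true]
      rcases h with h | h
      · exact ⟨v, fun hv => hne (by rw [← h, hv, hf.1]), by rw [h]⟩
      · exact ⟨w, fun hv => hne (by rw [← h, hv, hf.1]), by rw [h, Sym2.eq_swap]⟩
  have h1 := Nat.card_mono (Finset.finite_toSet _) hsub
  rw [Nat.card_eq_fintype_card (α := V), ← Finset.card_univ,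
    ← Finset.card_erase_add_one (mem_univ r)]
  refine Nat.add_le_add_right (h1.trans ?_) 1
  rw [Nat.card_coe_set_eq, Set.ncard_coe_finset]
  exact card_image_le

/-- The parent map of a rooted tree is determined by the tree: the set of vertices at which two
parent maps differ is closed under the first of them. -/
lemma IsRootedAt.eq_of_parentGraph_eq {f g : V → V} {r : V} (hf : IsRootedAt f r)
    (hg : IsRootedAt g r) (h : parentGraph f = parentGraph g) : f = g := by
  funext v
  by_contra hv
  refine hf.notMem_of_forall (S := fun v => f v ≠ g v) (by simp [hf.1, hg.1]) ?_ v hv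
  intro v hv hfv
  have hvr : v ≠ r := fun h => hv (by rw [h, hf.1, hg.1])
  have hadj : (parentGraph g).Adj v (f v) :=
    h ▸ parentGraph_adj.2 ⟨(hf.ne hvr).symm, Or.inl rfl⟩
  rcases (parentGraph_adj.1 hadj).2 with h1 | h1
  · exact hv h1.symm
  · -- now `f` swaps `v` and `f v`, so `v` never reaches the root
    rw [h1] at hfv
    refine hf.notMem_of_forall (S := fun w => w = v ∨ w = f v) ?_ ?_ v (Or.inl rfl)
    · rintro (h2 | h2)
      · exact hvr h2.symm
      · rw [← h2, hf.1] at hfv; exact hvr hfv.symm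
    · rintro w (rfl | rfl)
      · exact Or.inr rfl
      · exact Or.inl hfv

/-- Every tree is the graph of a parent map: send each vertex to a neighbour closer to the root. -/
lemma IsTree.exists_isRootedAt {T : SimpleGraph V} (hT : T.IsTree) (r : V) :
    ∃ f : V → V, IsRootedAt f r ∧ parentGraph f = T := by
  have step : ∀ v, ∃ w, (v = r → w = r) ∧ (v ≠ r → T.Adj v w ∧ T.dist w r < T.dist v r) := by
    intro v
    by_cases hv : v = r
    · exact ⟨r, fun _ => rfl, fun h => absurd hv h⟩
    · obtain ⟨p, hp⟩ := hT.connected.exists_walk_length_eq_dist v r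
      cases p with
      | nil => exact absurd rfl hv
      | cons h q =>
        refine ⟨_, fun h => absurd h hv, fun _ => ⟨h, ?_⟩⟩
        rw [← hp, Walk.length_cons]
        exact Nat.lt_succ_of_le (dist_le q)
  choose f hfr hf using step
  have hroot : IsRootedAt f r := by
    refine ⟨hfr r rfl, fun v => ?_⟩
    induction h : T.dist v r using Nat.strong_induction_on generalizing v with
    | _ d ih =>
      by_cases hv : v = r
      · exact ⟨0, hv⟩
      · obtain ⟨k, hk⟩ := ih _ (h ▸ (hf v hv).2) (f v) rfl
        exact ⟨k + 1, hk⟩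
  refine ⟨f, hroot, le_antisymm ?_ ?_⟩
  · intro v w h
    obtain ⟨hne, h⟩ := parentGraph_adj.1 h
    rcases h with rfl | rfl
    · exact (hf v fun hv => hne (by rw [hfr v hv, hv])).1
    · exact (hf w fun hv => hne (by rw [hfr w hv, hv])).1.symm
  · -- a connected subgraph of the tree `T` is all of `T`
    refine (isTree_iff_minimal_connected.1 hT).2 hroot.connected ?_
    intro v w h
    obtain ⟨hne, h⟩ := parentGraph_adj.1 h
    rcases h with rfl | rfl
    · exact (hf v fun hv => hne (by rw [hfr v hv, hv])).1
    · exact (hf w fun hv => hne (by rw [hfr w hv, hv])).1.symm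

variable [Fintype V] [DecidableEq V] (G : SimpleGraph V) [DecidableRel G.Adj] (r : V)

/-- The vertices allowed as a parent of `v` in a spanning tree of `G` rooted at `r`. -/
def parents (v : V) : Finset V := if v = r then {r} else G.neighborFinset v

lemma card_piFinset_parents :
    #(Fintype.piFinset (G.parents r)) = ∏ v ∈ univ.erase r, G.degree v := by
  rw [Fintype.card_piFinset, ← mul_prod_erase univ _ (mem_univ r)]
  simp only [parents, if_true, card_singleton, one_mul]
  refine prod_congr rfl fun v hv => ?_
  rw [if_neg (ne_of_mem_erase hv), card_neighborFinset_eq_degree]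

open Classical in
/-- Passing from a parent map to its graph is a bijection from the rooted parent maps along edges of
`G` to the spanning trees of `G`. -/
lemma numSpanningTrees_eq_card :
    numSpanningTrees G = #{f ∈ Fintype.piFinset (G.parents r) | IsRootedAt f r} := by
  rw [numSpanningTrees, ← Fintype.card_coe, ← Nat.card_eq_fintype_card]
  have mem : ∀ f : V → V, IsRootedAt f r →
      (f ∈ Fintype.piFinset (G.parents r) ↔ parentGraph f ≤ G) := by
    intro f hf
    rw [Fintype.mem_piFinset]
    constructor
    · intro h v w hvw
      obtain ⟨hne, hvw⟩ := parentGraph_adj.1 hvw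
      have key : ∀ v, v ≠ f v → G.Adj v (f v) := by
        intro v hv
        have hvr : v ≠ r := fun h => hv (by rw [h, hf.1])
        simpa [parents, hvr] using h v
      rcases hvw with rfl | rfl
      · exact key v hne
      · exact (key w hne.symm).symm
    · intro h v
      by_cases hv : v = r
      · simp [parents, hv, hf.1]
      · simpa [parents, hv] using h (parentGraph_adj.2 ⟨(hf.ne hv).symm, Or.inl rfl⟩)
  symm
  refine Nat.card_congr (Equiv.ofBijective (fun f => ⟨parentGraph f.1, ?_, ?_⟩) ⟨?_, ?_⟩)
  · obtain ⟨h1, h2⟩ := mem_filter.1 f.2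
    exact (mem _ h2).1 h1
  · exact (mem_filter.1 f.2).2.isTree
  · intro f g h
    exact Subtype.ext ((mem_filter.1 f.2).2.eq_of_parentGraph_eq (mem_filter.1 g.2).2
      (congrArg Subtype.val h))
  · rintro ⟨T, hTG, hT⟩
    obtain ⟨f, hf, rfl⟩ := hT.exists_isRootedAt r
    exact ⟨⟨f, mem_filter.2 ⟨(mem f hf).2 hTG, hf⟩⟩, rfl⟩

lemma Connected.numSpanningTrees_pos {V : Type*} [Finite V] {G : SimpleGraph V}
    (hG : G.Connected) : 0 < numSpanningTrees G := by
  obtain ⟨T, hT, hT'⟩ := hG.exists_isTree_le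
  have : Nonempty {T : SimpleGraph V // T ≤ G ∧ T.IsTree} := ⟨⟨T, hT, hT'⟩⟩
  exact Nat.card_pos

lemma numSpanningTrees_le_prod_degree :
    numSpanningTrees G ≤ ∏ v ∈ univ.erase r, G.degree v := by
  classical
  rw [numSpanningTrees_eq_card G r, ← card_piFinset_parents]
  exact card_filter_le _ _

/-! ### The matrix-tree theorem -/

/-- The row `e_v - e_w`, with the term `e_w` omitted if `w` is the root `r`. If `f` fixes `r`, the
matrix with rows `parentRow r v (f v)` is the Laplacian of the functional digraph `v → f v`, with row
and column `r` replaced by those of the identity matrix. -/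
def parentRow (v w : V) : V → ℝ :=
  Pi.single v 1 - if w = r then 0 else Pi.single w 1

/-- Ordered by distance to the root, the matrix is unitriangular. -/
lemma det_parentRow_of_isRootedAt {f : V → V} (hf : IsRootedAt f r) :
    (of fun v => parentRow r v (f v) : Matrix V V ℝ).det = 1 := by
  classical
  -- `b v` is the distance from `v` to the root along `f`
  let b : V → ℕ := fun v => Nat.find (hf.2 v)
  have hb : ∀ v, f v ≠ r → b (f v) < b v := by
    intro v hv
    have h0 : b v ≠ 0 := by
      intro h
      have h1 : f^[b v] v = r := Nat.find_spec (hf.2 v)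
      rw [h] at h1
      exact hv (by rw [show v = r from h1, hf.1])
    obtain ⟨k, hk⟩ := Nat.exists_eq_succ_of_ne_zero h0
    have h1 : f^[b v] v = r := Nat.find_spec (hf.2 v)
    rw [hk, Function.iterate_succ_apply] at h1
    rw [hk]
    exact Nat.lt_succ_of_le (Nat.find_min' _ h1)
  have entry : ∀ i j, b i ≤ b j → parentRow r i (f i) j = (1 : Matrix V V ℝ) i j := by
    intro i j hij
    have : (if f i = r then 0 else Pi.single (f i) 1 : V → ℝ) j = 0 := by
      split_ifs with h
      · rfl
      · refine Pi.single_eq_of_ne ?_ _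
        rintro rfl
        exact absurd (hb i h) (not_lt.2 hij)
    rw [parentRow, Pi.sub_apply, this, sub_zero, Matrix.one_apply, Pi.single_apply]
    simp only [eq_comm]
  have htri : BlockTriangular (of fun v => parentRow r v (f v) : Matrix V V ℝ)
      (OrderDual.toDual ∘ b) := by
    intro i j hij
    have hij' : b i < b j := hij
    rw [of_apply, entry i j hij'.le, Matrix.one_apply_ne]
    rintro rfl
    exact lt_irrefl _ hij'
  rw [htri.det]
  refine prod_eq_one fun k _ => ?_
  convert Matrix.det_one (R := ℝ) (n := { a // (OrderDual.toDual ∘ b) a = k }) using 2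
  ext i j
  have hij : b i.1 = b j.1 := OrderDual.toDual.injective (i.2.trans j.2.symm)
  rw [toSquareBlock_def, of_apply, of_apply, entry _ _ hij.le]
  simp [Matrix.one_apply, Subtype.ext_iff]

lemma det_parentRow_of_not_isRootedAt {f : V → V} (hr : f r = r) (hf : ¬ IsRootedAt f r) :
    (of fun v => parentRow r v (f v) : Matrix V V ℝ).det = 0 := by
  classical
  -- the indicator function of the vertices that never reach the root is in the kernel
  let S : V → Prop := fun v => ∀ k, f^[k] v ≠ r
  have hS : ∀ v, S (f v) ↔ S v := by
    intro v
    refine ⟨fun h k hk => ?_, fun h k => by simpa using h (k + 1)⟩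
    refine h k ?_
    rw [← Function.iterate_succ_apply, Function.iterate_succ_apply', hk, hr]
  rw [← exists_mulVec_eq_zero_iff]
  refine ⟨fun v => if S v then 1 else 0, ?_, ?_⟩
  · intro h
    refine hf ⟨hr, fun v => ?_⟩
    by_contra hv
    have := congrFun h v
    have hSv : S v := fun k hk => hv ⟨k, hk⟩
    simp [hSv] at this
  · ext v
    have hv : f v = r → ¬ S v := fun h hv => hv 1 h
    simp only [mulVec, of_apply, parentRow, sub_dotProduct, single_one_dotProduct, Pi.zero_apply]
    by_cases h1 : f v = r
    · simp [h1, hv h1]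
    · simp [h1, hS]

/-- The reduced Laplacian: the Laplacian with the row and the column of the root `r` replaced by
those of the identity matrix. Its determinant is that of the Laplacian with row and column `r`
deleted. -/
def reducedLaplacian : Matrix V V ℝ :=
  of fun v w => if v = r ∨ w = r then (1 : Matrix V V ℝ) v w else G.lapMatrix ℝ v w

lemma reducedLaplacian_row (v : V) :
    G.reducedLaplacian r v = ∑ w ∈ G.parents r v, parentRow r v w := by
  ext u
  rw [reducedLaplacian, of_apply]
  by_cases hv : v = r
  · subst hv
    simp [parents, parentRow, Matrix.one_apply, Pi.single_apply, eq_comm]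
  · have h1 : ∀ w, parentRow r v w u
        = (1 : Matrix V V ℝ) v u - if w = u then (if u = r then 0 else 1) else 0 := by
      intro w
      simp only [parentRow, Pi.sub_apply, Pi.single_apply, Matrix.one_apply, eq_comm (a := u)]
      by_cases hwu : w = u
      · subst hwu
        by_cases hw : w = r
        · simp [hw]
        · simp [hw, Ne.symm hw]
      · by_cases hw : w = r
        · subst hw
          simp [hwu]
        · simp [hw, hwu]
    rw [Finset.sum_apply]
    simp_rw [h1]
    rw [sum_sub_distrib, sum_const, sum_ite_eq', parents, if_neg hv, card_neighborFinset_eq_degree]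
    by_cases hu : u = r
    · simp [hu, hv]
    · by_cases huv : v = u
      · subst huv
        simp [hv, lapMatrix, degMatrix]
      · simp [hu, hv, huv, lapMatrix, degMatrix, adjMatrix_apply]

/-- Kirchhoff's **matrix-tree theorem**. Expanding the determinant in the rows gives a sum over
all choices of a parent for each vertex, in which exactly the rooted trees contribute. -/
theorem det_reducedLaplacian : (G.reducedLaplacian r).det = numSpanningTrees G := by
  classical
  have h : (G.reducedLaplacian r).det = detRowAlternating (R := ℝ) (n := V)
      (fun v => ∑ w ∈ G.parents r v, parentRow r v w) := by
    rw [← funext (G.reducedLaplacian_row r)]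
    rfl
  have h2 := MultilinearMap.map_sum_finset
    (detRowAlternating (R := ℝ) (n := V)).toMultilinearMap (parentRow r) (G.parents r)
  rw [h, numSpanningTrees_eq_card G r, card_filter, Nat.cast_sum]
  refine h2.trans (sum_congr rfl fun f hf => ?_)
  have hr : f r = r := by simpa [parents] using Fintype.mem_piFinset.1 hf r
  by_cases hroot : IsRootedAt f r
  · rw [if_pos hroot, Nat.cast_one]
    exact det_parentRow_of_isRootedAt r hroot
  · rw [if_neg hroot, Nat.cast_zero]
    exact det_parentRow_of_not_isRootedAt r hr hroot

end SimpleGraph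

/-! ### Determinants close to the identity -/

section Spectral

open Finset Matrix

variable {V : Type*} [Fintype V] [DecidableEq V]

lemma Matrix.IsHermitian.trace_mul_self_eq_sum_eigenvalues_sq {A : Matrix V V ℝ}
    (hA : A.IsHermitian) : (A * A).trace = ∑ i, hA.eigenvalues i ^ 2 := by
  conv_lhs => rw [hA.spectral_theorem, ← map_mul, Unitary.conjStarAlgAut_apply, trace_mul_cycle]
  simp [trace, sq]

/-- A quantitative form of `log t ≈ t - 1`, in which small values of `t` cost only a factor `|log g|`. -/
lemma Real.sub_one_sub_mul_sq_le_log {g t : ℝ} (hg : 0 < g) (hg' : g ≤ 1 / 2) (ht : g ≤ t) :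
    (t - 1) - (2 - 4 * Real.log g) * (t - 1) ^ 2 ≤ Real.log t := by
  have hlg : Real.log g ≤ 0 := Real.log_nonpos hg.le (by linarith)
  have ht0 : 0 < t := hg.trans_le ht
  rcases le_total (1 / 2) t with h | h
  · have h1 := Real.one_sub_inv_le_log_of_pos ht0
    have h2 : 1 - t⁻¹ = (t - 1) - t⁻¹ * (t - 1) ^ 2 := by field_simp; ring
    have h3 : t⁻¹ ≤ 2 := by
      rw [inv_le_comm₀ ht0 two_pos]; linarith
    nlinarith [mul_nonneg (sub_nonneg.2 h3) (sq_nonneg (t - 1)),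
      mul_nonneg (neg_nonneg.2 hlg) (sq_nonneg (t - 1))]
  · have h1 := Real.log_le_log hg ht
    have h2 : 1 / 4 ≤ (t - 1) ^ 2 := by nlinarith
    nlinarith [mul_nonneg (neg_nonneg.2 hlg) (sub_nonneg.2 h2), sq_nonneg (t - 1)]

/-- A lower bound for the determinant of a symmetric perturbation `A` of the identity in terms of
the Frobenius norm of `A - 1`. As `A` has trace `|V|`, the linear terms `μ - 1` in the expansion of
`log μ` cancel in the sum over the eigenvalues. -/
lemma Matrix.IsHermitian.le_log_det {A : Matrix V V ℝ} (hA : A.IsHermitian)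
    (hdiag : ∀ v, A v v = 1) {g : ℝ} (hg : 0 < g) (hg' : g ≤ 1 / 2)
    (hpos : ∀ x : V → ℝ, g * (x ⬝ᵥ x) ≤ x ⬝ᵥ A *ᵥ x) :
    -((2 - 4 * Real.log g) * ∑ v, ∑ w, (A - 1) v w ^ 2) ≤ Real.log A.det := by
  have heig : ∀ i, g ≤ hA.eigenvalues i := by
    intro i
    have h := hpos (hA.eigenvectorBasis i)
    rw [hA.mulVec_eigenvectorBasis, dotProduct_smul, smul_eq_mul] at h
    refine le_of_mul_le_mul_right h ?_
    have hne : (hA.eigenvectorBasis i).ofLp ≠ 0 :=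
      (WithLp.ofLp_eq_zero 2).ne.2 (hA.eigenvectorBasis.orthonormal.ne_zero i)
    have := (dotProduct_star_self_pos_iff (v := (hA.eigenvectorBasis i).ofLp)).2 hne
    simpa using this
  have htr : ∑ i, hA.eigenvalues i = Fintype.card V := by
    have := hA.trace_eq_sum_eigenvalues
    simp only [trace, diag_apply, hdiag] at this
    simpa using this.symm
  have hfrob : ∑ v, ∑ w, (A - 1) v w ^ 2 = ∑ i, (hA.eigenvalues i - 1) ^ 2 := by
    have h1 : ∑ v, ∑ w, (A - 1) v w ^ 2 = ((A - 1) * (A - 1)).trace := by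
      simp only [trace, diag_apply, mul_apply]
      refine sum_congr rfl fun v _ => sum_congr rfl fun w _ => ?_
      rw [sq, (hA.sub isHermitian_one).apply v w |>.symm]
      simp
    have h2 : (A - 1) * (A - 1) = A * A - A - A + 1 := by noncomm_ring
    have h3 : A.trace = Fintype.card V := by simp [trace, hdiag]
    rw [h1, h2, trace_add, trace_sub, trace_sub, hA.trace_mul_self_eq_sum_eigenvalues_sq,
      trace_one, h3]
    simp only [sub_sq, sum_add_distrib, sum_sub_distrib, mul_one, ← mul_sum, htr]
    simp
    ring
  rw [hA.det_eq_prod_eigenvalues]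
  simp only [RCLike.ofReal_real_eq_id, id_eq]
  rw [Real.log_prod fun i _ => (hg.trans_le (heig i)).ne', hfrob]
  calc -((2 - 4 * Real.log g) * ∑ i, (hA.eigenvalues i - 1) ^ 2)
      = ∑ i, ((hA.eigenvalues i - 1)
          - (2 - 4 * Real.log g) * (hA.eigenvalues i - 1) ^ 2) := by
        rw [sum_sub_distrib, sum_sub_distrib, htr, ← mul_sum]
        simp
    _ ≤ _ := sum_le_sum fun i _ => Real.sub_one_sub_mul_sq_le_log hg hg' (heig i)

end Spectral

/-! ### Spanning trees and the product of the degrees -/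

namespace SimpleGraph

open Finset Matrix

variable {V : Type*} [Fintype V] [DecidableEq V] {G : SimpleGraph V} [DecidableRel G.Adj]

/-- A Poincaré inequality. The increment of `y` over each edge is at most the square root of twice the
Dirichlet energy, and these increments are summed along a path from `v` to `r`. -/
lemma Connected.sq_le_lapMatrix (hG : G.Connected) {r : V} {y : V → ℝ} (hr : y r = 0) (v : V) :
    y v ^ 2 ≤ 2 * (Fintype.card V : ℝ) ^ 2 * (y ⬝ᵥ G.lapMatrix ℝ *ᵥ y) := by
  set E := y ⬝ᵥ G.lapMatrix ℝ *ᵥ y with hE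
  have hE2 : 2 * E = ∑ i : V, ∑ j : V, if G.Adj i j then (y i - y j) ^ 2 else 0 := by
    rw [hE, ← toLinearMap₂'_apply', lapMatrix_toLinearMap₂']
    ring
  have hnn : ∀ i j, 0 ≤ if G.Adj i j then (y i - y j) ^ 2 else 0 := fun i j => by positivity
  have hE0 : 0 ≤ 2 * E := hE2 ▸ sum_nonneg fun i _ => sum_nonneg fun j _ => hnn i j
  have hstep : ∀ i j, G.Adj i j → |y i - y j| ≤ √(2 * E) := by
    intro i j hij
    refine Real.abs_le_sqrt ?_
    calc (y i - y j) ^ 2 = if G.Adj i j then (y i - y j) ^ 2 else 0 := by rw [if_pos hij]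
      _ ≤ ∑ j, if G.Adj i j then (y i - y j) ^ 2 else 0 :=
        single_le_sum (f := fun j => if G.Adj i j then (y i - y j) ^ 2 else 0)
          (fun j _ => hnn i j) (mem_univ j)
      _ ≤ _ := hE2 ▸ single_le_sum
          (f := fun i => ∑ j, if G.Adj i j then (y i - y j) ^ 2 else 0)
          (fun i _ => sum_nonneg fun j _ => hnn i j) (mem_univ i)
  have hwalk : ∀ {i j : V} (p : G.Walk i j), |y i - y j| ≤ p.length * √(2 * E) := by
    intro i j p
    induction p with
    | nil => simp
    | cons h q ih =>
      rw [Walk.length_cons, Nat.cast_succ, add_one_mul, add_comm]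
      exact (abs_sub_le _ _ _).trans (add_le_add (hstep _ _ h) ih)
  obtain ⟨p, hp⟩ := hG.exists_isPath v r
  have hlen : (p.length : ℝ) ≤ Fintype.card V := by exact_mod_cast hp.length_lt.le
  have h := (hwalk p).trans (mul_le_mul_of_nonneg_right hlen (Real.sqrt_nonneg _))
  rw [hr, sub_zero] at h
  calc y v ^ 2 = |y v| ^ 2 := (sq_abs _).symm
    _ ≤ (Fintype.card V * √(2 * E)) ^ 2 := pow_le_pow_left₀ (abs_nonneg _) h 2
    _ = _ := by rw [mul_pow, Real.sq_sqrt hE0]; ring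

lemma reducedLaplacian_isHermitian (r : V) : (G.reducedLaplacian r).IsHermitian := by
  ext v w
  have h1 : G.lapMatrix ℝ w v = G.lapMatrix ℝ v w := (G.isSymm_lapMatrix (R := ℝ)).apply _ _
  simp only [conjTranspose_apply, star_trivial, reducedLaplacian, of_apply, h1, or_comm,
    Matrix.one_apply, eq_comm]

lemma dotProduct_reducedLaplacian (r : V) (z : V → ℝ) :
    z ⬝ᵥ G.reducedLaplacian r *ᵥ z
      = z r ^ 2 + Function.update z r 0 ⬝ᵥ G.lapMatrix ℝ *ᵥ Function.update z r 0 := by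
  have hsq : z r ^ 2 = ∑ v, ∑ w, if v = r then if w = r then z r ^ 2 else 0 else 0 := by simp
  rw [hsq]
  simp only [dotProduct, mulVec, mul_sum]
  rw [← sum_add_distrib]
  refine sum_congr rfl fun v _ => ?_
  rw [← sum_add_distrib]
  refine sum_congr rfl fun w _ => ?_
  by_cases hv : v = r
  · subst hv
    by_cases hw : w = v
    · subst hw
      simp [reducedLaplacian, sq]
    · simp [reducedLaplacian, hw, Matrix.one_apply_ne (Ne.symm hw)]
  · by_cases hw : w = r
    · subst hw
      simp [reducedLaplacian, hv]
    · simp [reducedLaplacian, hv, hw]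

/-- The degrees, with that of the root replaced by `1`: the diagonal of the reduced Laplacian. -/
def rootedDegree (G : SimpleGraph V) [DecidableRel G.Adj] (r v : V) : ℝ :=
  if v = r then 1 else G.degree v

lemma reducedLaplacian_apply_self (r v : V) :
    G.reducedLaplacian r v v = G.rootedDegree r v := by
  by_cases hv : v = r <;> simp [reducedLaplacian, rootedDegree, hv, lapMatrix, degMatrix]

/-- A spectral gap that is polynomial in the number of vertices. -/
lemma Connected.le_dotProduct_reducedLaplacian (hG : G.Connected) (r : V) (z : V → ℝ) :
    (2 * (Fintype.card V : ℝ) ^ 4)⁻¹ * ∑ v, G.rootedDegree r v * z v ^ 2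
      ≤ z ⬝ᵥ G.reducedLaplacian r *ᵥ z := by
  set n : ℝ := (Fintype.card V : ℝ)
  set y := Function.update z r 0
  have : Nonempty V := ⟨r⟩
  have hn : 1 ≤ n := Nat.one_le_cast.2 Fintype.card_pos
  have hn4 : 1 ≤ n ^ 4 := one_le_pow₀ hn
  rw [dotProduct_reducedLaplacian, inv_mul_le_iff₀ (by positivity)]
  set E := y ⬝ᵥ G.lapMatrix ℝ *ᵥ y
  have hE : ∀ v, y v ^ 2 ≤ 2 * n ^ 2 * E := hG.sq_le_lapMatrix (r := r) (by simp [y])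
  calc ∑ v, G.rootedDegree r v * z v ^ 2
      ≤ ∑ v, ((if v = r then z r ^ 2 else 0) + n * (2 * n ^ 2 * E)) := by
        refine sum_le_sum fun v _ => ?_
        have h0 := (sq_nonneg (y v)).trans (hE v)
        by_cases hv : v = r
        · subst hv
          simp only [rootedDegree, if_true, one_mul]
          exact le_add_of_nonneg_right (mul_nonneg (by positivity) h0)
        · simp only [rootedDegree, hv, if_false, zero_add]
          have hd : (G.degree v : ℝ) ≤ n := Nat.cast_le.2 (G.degree_lt_card_verts v).le
          have hy : y v = z v := Function.update_of_ne hv _ _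
          exact mul_le_mul hd (hy ▸ hE v) (sq_nonneg _) (by positivity)
    _ = z r ^ 2 + n * (n * (2 * n ^ 2 * E)) := by
        simp [sum_add_distrib, n]
    _ ≤ 2 * n ^ 4 * (z r ^ 2 + E) := by
        nlinarith [mul_nonneg (sub_nonneg.2 hn4) (sq_nonneg (z r)), sq_nonneg (z r)]

/-- A connected graph of minimum degree at least `a` has, up to a factor `exp (O(log n) * n / a)`, as
many spanning trees as the product of its degrees. The determinant of the reduced Laplacian is the
product of the degrees times the determinant of the normalized matrix `B`, whose off-diagonal entries
have squares at most `1 / (deg v * a)`. -/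
theorem Connected.le_log_numSpanningTrees (hG : G.Connected) (r : V) {a : ℝ} (ha : 0 < a)
    (hdeg : ∀ v, a ≤ G.degree v) :
    ∑ v ∈ univ.erase r, Real.log (G.degree v)
      - (2 + 4 * Real.log (2 * (Fintype.card V : ℝ) ^ 4)) * (Fintype.card V / a)
      ≤ Real.log (numSpanningTrees G) := by
  set n : ℝ := (Fintype.card V : ℝ)
  have : Nonempty V := ⟨r⟩
  have hn : 1 ≤ n := Nat.one_le_cast.2 Fintype.card_pos
  have hn4 : 1 ≤ n ^ 4 := one_le_pow₀ hn
  set c := G.rootedDegree r with hc_def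
  have hd : ∀ v, 0 < (G.degree v : ℝ) := fun v => ha.trans_le (hdeg v)
  have hc : ∀ v, 0 < c v := by
    intro v
    by_cases hv : v = r <;> simp only [c, rootedDegree, hv, if_true, if_false]
    · exact one_pos
    · exact hd v
  set s : V → ℝ := fun v => (√(c v))⁻¹ with hs_def
  have hs : ∀ v, s v * s v = (c v)⁻¹ := fun v => by
    rw [hs_def, ← mul_inv, Real.mul_self_sqrt (hc v).le]
  set M := G.reducedLaplacian r with hM
  set B : Matrix V V ℝ := diagonal s * M * diagonal s with hB_def
  have hB : ∀ v w, B v w = s v * M v w * s w := fun v w => by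
    simp [B, diagonal_mul, mul_diagonal]
  have hBh : B.IsHermitian := by
    have := isHermitian_conjTranspose_mul_mul (diagonal s) (G.reducedLaplacian_isHermitian r)
    simpa [diagonal_conjTranspose] using this
  have hdiag : ∀ v, B v v = 1 := by
    intro v
    rw [hB, hM, reducedLaplacian_apply_self, mul_right_comm, hs, inv_mul_cancel₀ (hc v).ne']
  have hpos : ∀ x : V → ℝ, (2 * n ^ 4)⁻¹ * (x ⬝ᵥ x) ≤ x ⬝ᵥ B *ᵥ x := by
    intro x
    have h := hG.le_dotProduct_reducedLaplacian r (fun v => s v * x v)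
    have h1 : ∑ v, c v * (s v * x v) ^ 2 = x ⬝ᵥ x := by
      refine sum_congr rfl fun v _ => ?_
      rw [mul_pow, sq (s v), hs, mul_inv_cancel_left₀ (hc v).ne', sq]
    have h2 : (fun v => s v * x v) ⬝ᵥ M *ᵥ (fun v => s v * x v) = x ⬝ᵥ B *ᵥ x := by
      simp only [dotProduct, mulVec, hB, mul_sum]
      exact sum_congr rfl fun v _ => sum_congr rfl fun w _ => by ring
    rwa [h1, h2] at h
  have hfrob : ∑ v, ∑ w, (B - 1) v w ^ 2 ≤ n / a := by
    have hentry : ∀ v w, (B - 1) v w ^ 2 ≤ if G.Adj v w then (G.degree v * a)⁻¹ else 0 := by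
      intro v w
      by_cases hvw : v = w
      · subst hvw
        simp [hdiag]
      · rw [Matrix.sub_apply, Matrix.one_apply_ne hvw, sub_zero, hB]
        by_cases hr : v = r ∨ w = r
        · rw [hM, reducedLaplacian, of_apply, if_pos hr, Matrix.one_apply_ne hvw]
          have := (mul_pos (hd v) ha).le
          split_ifs <;> simp
          positivity
        · have hMvw : M v w = if G.Adj v w then -1 else 0 := by
            rw [hM, reducedLaplacian, of_apply, if_neg hr]
            by_cases h : G.Adj v w <;> simp [lapMatrix, degMatrix, hvw, adjMatrix_apply, h]
          rw [hMvw]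
          split_ifs
          · push Not at hr
            have h1 : (s v * -1 * s w) ^ 2 = (c v * c w)⁻¹ := by
              rw [mul_inv, ← hs, ← hs]; ring
            rw [h1]
            refine inv_anti₀ (mul_pos (hd v) ha) ?_
            simp only [c, rootedDegree, hr.1, hr.2, if_false]
            exact mul_le_mul_of_nonneg_left (hdeg w) (hd v).le
          · simp
    calc ∑ v, ∑ w, (B - 1) v w ^ 2
        ≤ ∑ v, ∑ w, if G.Adj v w then ((G.degree v : ℝ) * a)⁻¹ else 0 :=
          sum_le_sum fun v _ => sum_le_sum fun w _ => hentry v w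
      _ = ∑ v : V, a⁻¹ := by
          refine sum_congr rfl fun v _ => ?_
          rw [← sum_filter, ← neighborFinset_eq_filter, sum_const, card_neighborFinset_eq_degree,
            nsmul_eq_mul, mul_inv, mul_inv_cancel_left₀ (hd v).ne']
      _ = n / a := by simp [n, div_eq_mul_inv]
  have hg : (2 * n ^ 4)⁻¹ ≤ 1 / 2 := by
    rw [one_div]; exact inv_anti₀ two_pos (by linarith)
  have key := hBh.le_log_det hdiag (by positivity) hg hpos
  have hdet : B.det = (∏ v, (c v)⁻¹) * numSpanningTrees G := by
    rw [hB_def, det_mul, det_mul, det_diagonal, hM, det_reducedLaplacian]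
    simp_rw [← hs, prod_mul_distrib]
    ring
  have hprod : Real.log (∏ v, (c v)⁻¹) = -∑ v ∈ univ.erase r, Real.log (G.degree v) := by
    rw [Real.log_prod fun v _ => (inv_pos.2 (hc v)).ne', ← add_sum_erase univ _ (mem_univ r)]
    simp only [Real.log_inv, sum_neg_distrib]
    rw [sum_congr rfl fun v hv => by
      rw [hc_def, rootedDegree, if_neg (ne_of_mem_erase hv)]]
    simp [c, rootedDegree]
  have ht : (numSpanningTrees G : ℝ) ≠ 0 := Nat.cast_ne_zero.2 hG.numSpanningTrees_pos.ne'
  rw [hdet, Real.log_mul (prod_pos fun v _ => inv_pos.2 (hc v)).ne' ht, hprod, Real.log_inv] at key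
  have hK : 0 ≤ 2 + 4 * Real.log (2 * n ^ 4) := by
    have := Real.log_nonneg (show 1 ≤ 2 * n ^ 4 by linarith)
    positivity
  nlinarith [mul_le_mul_of_nonneg_left hfrob hK]

end SimpleGraph

/-! ### Degrees and the cut distance -/

namespace Graphon

section

variable {Ω : Type*} [MeasurableSpace Ω] {μ : Measure Ω}

lemma norm_toFun_le (W : Graphon μ) (x y : Ω) : ‖W.toFun x y‖ ≤ 1 := by
  rw [Real.norm_of_nonneg (W.nonneg x y)]
  exact W.le_one x y

variable [IsProbabilityMeasure μ]

lemma norm_deg_le (W : Graphon μ) (x : Ω) : ‖W.deg x‖ ≤ 1 := by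
  simpa [deg] using norm_integral_le_of_norm_le_const (μ := μ)
    (Eventually.of_forall fun y => W.norm_toFun_le x y)

lemma aemeasurable_deg (W : Graphon μ) : AEMeasurable W.deg μ :=
  (W.aemeasurable.aestronglyMeasurable.integral_prod_right').aemeasurable

lemma integrable_deg (W : Graphon μ) : Integrable W.deg μ :=
  .of_bound W.aemeasurable_deg.aestronglyMeasurable 1 (Eventually.of_forall W.norm_deg_le)

lemma ae_integrable_section (W : Graphon μ) : ∀ᵐ x ∂μ, Integrable (W.toFun x) μ := by
  filter_upwards [W.aemeasurable.aestronglyMeasurable.prodMk_left] with x hx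
  exact .of_bound hx 1 (Eventually.of_forall (W.norm_toFun_le x))

/-- The cut norm dominates the `L¹`-distance of the degree functions: test it on `S × Ω`, where `S`
is the set on which the difference of the degrees is nonnegative, and on `Sᶜ × Ω`. -/
lemma integral_abs_deg_sub_le {W₁ W₂ : Graphon μ} {φ : Ω ≃ᵐ Ω} (hφ : MeasurePreserving φ μ μ)
    {ε : ℝ} (hε : 0 ≤ ε)
    (h : cutNorm μ (fun x y => W₁.toFun (φ x) (φ y) - W₂.toFun x y) ≤ ENNReal.ofReal ε) :
    ∫ x, |W₁.deg (φ x) - W₂.deg x| ∂μ ≤ 2 * ε := by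
  set f : Ω → ℝ := fun x => W₁.deg (φ x) - W₂.deg x
  have hf : Integrable f μ :=
    (hφ.integrable_comp_of_integrable W₁.integrable_deg).sub W₂.integrable_deg
  have hinner : ∀ᵐ x ∂μ, ∫ y in Set.univ, (W₁.toFun (φ x) (φ y) - W₂.toFun x y) ∂μ = f x := by
    filter_upwards [hφ.quasiMeasurePreserving.ae W₁.ae_integrable_section,
      W₂.ae_integrable_section] with x h1 h2
    have h3 : Integrable (fun y => W₁.toFun (φ x) (φ y)) μ := hφ.integrable_comp_of_integrable h1
    rw [setIntegral_univ, integral_sub h3 h2]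
    congr 1
    exact hφ.integral_comp' (W₁.toFun (φ x))
  have hset : ∀ S, MeasurableSet S → |∫ x in S, f x ∂μ| ≤ ε := by
    intro S hS
    rw [← integral_congr_ae (ae_restrict_of_ae hinner), ← ENNReal.ofReal_le_ofReal_iff hε]
    refine le_trans ?_ h
    exact le_iSup₂_of_le S hS (le_iSup₂_of_le Set.univ MeasurableSet.univ le_rfl)
  obtain ⟨g, hg, hfg⟩ := hf.aestronglyMeasurable.aemeasurable
  let S : Set Ω := {x | 0 ≤ g x}
  have hS : MeasurableSet S := measurableSet_le measurable_const hg
  have h1 : ∫ x in S, |f x| ∂μ = ∫ x in S, f x ∂μ := by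
    refine setIntegral_congr_ae hS ?_
    filter_upwards [hfg] with x hx hxS
    rw [hx, abs_of_nonneg hxS]
  have h2 : ∫ x in Sᶜ, |f x| ∂μ = -∫ x in Sᶜ, f x ∂μ := by
    rw [← integral_neg]
    refine setIntegral_congr_ae hS.compl ?_
    filter_upwards [hfg] with x hx hxS
    rw [hx, abs_of_neg (not_le.1 (show ¬ 0 ≤ g x from hxS))]
  rw [← integral_add_compl hS hf.abs, h1, h2]
  have h3 := (abs_le.1 (hset S hS)).2
  have h4 := (abs_le.1 (hset Sᶜ hS.compl)).1
  linarith

lemma integral_comp_cell {n : ℕ} (P : EquiPartition μ n) (F : Fin n → ℝ) :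
    ∫ x, F (P.cell x) ∂μ = (∑ v, F v) / n := by
  have := Measure.isProbabilityMeasure_map (μ := μ) P.measurable_cell.aemeasurable
  rw [← integral_map P.measurable_cell.aemeasurable
    (measurable_of_countable F).aestronglyMeasurable, integral_fintype .of_finite, Finset.sum_div]
  refine Finset.sum_congr rfl fun v _ => ?_
  rw [measureReal_def, Measure.map_apply P.measurable_cell (measurableSet_singleton v),
    P.measure_cell v, ENNReal.toReal_inv, ENNReal.toReal_natCast, smul_eq_mul, mul_comm,
    div_eq_mul_inv]

lemma integrable_comp_cell {n : ℕ} (P : EquiPartition μ n) (F : Fin n → ℝ) :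
    Integrable (fun x => F (P.cell x)) μ :=
  (Integrable.of_finite (μ := μ.map P.cell) (f := F)).comp_measurable P.measurable_cell

lemma deg_ofGraph {n : ℕ} (P : EquiPartition μ n) (G : SimpleGraph (Fin n))
    [DecidableRel G.Adj] (x : Ω) : (ofGraph P G).deg x = G.degree (P.cell x) / n := by
  have h := integral_comp_cell P (fun v => if G.Adj (P.cell x) v then 1 else 0)
  rw [SimpleGraph.degree_eq_sum_if_adj (G := G) (R := ℝ), ← h, deg]
  refine integral_congr_ae (Eventually.of_forall fun y => ?_)
  simp only [ofGraph]
  congr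

/-- A sequence converging to `W` has degree functions that converge in `L¹` to `deg_W`, up to
rearrangement by measure preserving automorphisms. -/
lemma GraphsConvergeTo.eventually_exists {G : (n : ℕ) → SimpleGraph (Fin n)}
    [∀ n, DecidableRel (G n).Adj] {W : Graphon μ} (h : GraphsConvergeTo G W) {ε : ℝ} (hε : 0 < ε) :
    ∀ᶠ n in atTop, ∃ (P : EquiPartition μ n) (φ : Ω ≃ᵐ Ω), MeasurePreserving φ μ μ ∧
      ∫ x, |W.deg (φ x) - (G n).degree (P.cell x) / n| ∂μ ≤ ε := by
  have hε2 : 0 < ε / 2 := half_pos hε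
  filter_upwards [h.eventually (gt_mem_nhds (ENNReal.ofReal_pos.2 hε2))] with n hn
  obtain ⟨P, hP⟩ := iInf_lt_iff.1 hn
  obtain ⟨φ, hφ⟩ := iInf_lt_iff.1 hP
  obtain ⟨hφ, hlt⟩ := iInf_lt_iff.1 hφ
  refine ⟨P, φ, hφ, ?_⟩
  have := integral_abs_deg_sub_le hφ hε2.le hlt.le
  simp only [deg_ofGraph] at this
  linarith

end

end Graphon

lemma Real.abs_log_sub_log_le {δ a b : ℝ} (hδ : 0 < δ) (ha : δ ≤ a) (hb : δ ≤ b) :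
    |Real.log a - Real.log b| ≤ |a - b| / δ := by
  have key : ∀ {a b : ℝ}, δ ≤ a → δ ≤ b → Real.log a - Real.log b ≤ |a - b| / δ := by
    intro a b ha hb
    have ha0 := hδ.trans_le ha
    have hb0 := hδ.trans_le hb
    rw [← Real.log_div ha0.ne' hb0.ne']
    calc Real.log (a / b) ≤ a / b - 1 := Real.log_le_sub_one_of_pos (div_pos ha0 hb0)
      _ = (a - b) / b := by rw [sub_div, div_self hb0.ne']
      _ ≤ |a - b| / b := div_le_div_of_nonneg_right (le_abs_self _) hb0.le
      _ ≤ |a - b| / δ := div_le_div_of_nonneg_left (abs_nonneg _) hδ hb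
  refine abs_sub_le_iff.2 ⟨key ha hb, ?_⟩
  rw [abs_sub_comm]
  exact key hb ha

namespace Graphon

variable {Ω : Type*} [MeasurableSpace Ω] {μ : Measure Ω} [IsProbabilityMeasure μ]
  {G : (n : ℕ) → SimpleGraph (Fin n)} [∀ n, DecidableRel (G n).Adj] {W : Graphon μ} {δ : ℝ}

/-- A linear lower bound on the degrees passes to the limit. -/
lemma GraphsConvergeTo.le_deg (h : GraphsConvergeTo G W)
    (hdeg : ∀ᶠ n : ℕ in atTop, ∀ v, δ ≤ ((G n).degree v : ℝ) / n) :
    ∀ᵐ x ∂μ, δ ≤ W.deg x := by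
  have hint : Integrable (fun x => max (δ - W.deg x) 0) μ :=
    ((integrable_const δ).sub W.integrable_deg).pos_part
  have hzero : ∫ x, max (δ - W.deg x) 0 ∂μ = 0 := by
    refine le_antisymm (le_of_forall_pos_le_add fun ε hε => ?_)
      (integral_nonneg fun x => le_max_right _ _)
    obtain ⟨n, hn, P, φ, hφ, hle⟩ := (hdeg.and (h.eventually_exists hε)).exists
    rw [zero_add, ← hφ.integral_comp' (fun x => max (δ - W.deg x) 0)]
    refine le_trans (integral_mono_of_nonneg (Eventually.of_forall fun x => le_max_right _ _) ?_
      (Eventually.of_forall fun x => ?_)) hle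
    · exact ((hφ.integrable_comp_of_integrable W.integrable_deg).sub
        (integrable_comp_cell P fun v => ((G n).degree v : ℝ) / n)).abs
    · refine max_le ?_ (abs_nonneg _)
      have h1 := hn (P.cell x)
      have h2 := neg_abs_le (W.deg (φ x) - (G n).degree (P.cell x) / n)
      linarith
  have hae := (integral_eq_zero_iff_of_nonneg (fun x => le_max_right _ _) hint).1 hzero
  filter_upwards [hae] with x hx
  have : δ - W.deg x ≤ 0 := max_eq_right_iff.1 hx
  linarith

lemma integrable_log_deg (hδ : 0 < δ) (hW : ∀ᵐ x ∂μ, δ ≤ W.deg x) :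
    Integrable (fun x => Real.log (W.deg x)) μ := by
  refine .of_bound (Real.measurable_log.comp_aemeasurable W.aemeasurable_deg).aestronglyMeasurable
    (-Real.log δ) ?_
  filter_upwards [hW] with x hx
  rw [Real.norm_of_nonpos]
  · exact neg_le_neg (Real.log_le_log hδ hx)
  · exact Real.log_nonpos (hδ.le.trans hx) ((le_abs_self _).trans (W.norm_deg_le x))

/-- Above `δ` the logarithm is Lipschitz, so convergence of the degrees in `L¹` gives convergence of
the mean logarithm of the degree. -/
lemma GraphsConvergeTo.tendsto_average_log_degree (h : GraphsConvergeTo G W) (hδ : 0 < δ)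
    (hdeg : ∀ᶠ n : ℕ in atTop, ∀ v, δ ≤ ((G n).degree v : ℝ) / n) :
    Tendsto (fun n : ℕ => (∑ v, Real.log ((G n).degree v / n)) / n) atTop
      (𝓝 (∫ x, Real.log (W.deg x) ∂μ)) := by
  have hW := h.le_deg hdeg
  have hWint := integrable_log_deg hδ hW
  rw [Metric.tendsto_atTop']
  intro ε hε
  obtain ⟨N, hN⟩ := eventually_atTop.1 (hdeg.and (h.eventually_exists
    (mul_pos hδ (half_pos hε))))
  refine ⟨N, fun n hn => ?_⟩
  obtain ⟨hdn, P, φ, hφ, hle⟩ := hN n hn.le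
  have hWφ : Integrable (fun x => Real.log (W.deg (φ x))) μ :=
    hφ.integrable_comp_of_integrable hWint
  rw [Real.dist_eq, abs_sub_comm,
    ← integral_comp_cell P fun v => Real.log ((G n).degree v / n),
    ← hφ.integral_comp' (fun x => Real.log (W.deg x)),
    ← integral_sub hWφ (integrable_comp_cell P fun v => Real.log ((G n).degree v / n))]
  calc _ ≤ ∫ x, |Real.log (W.deg (φ x)) - Real.log ((G n).degree (P.cell x) / n)| ∂μ :=
        abs_integral_le_integral_abs
    _ ≤ ∫ x, |W.deg (φ x) - (G n).degree (P.cell x) / n| / δ ∂μ := by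
        refine integral_mono_ae
          (hWφ.sub (integrable_comp_cell P fun v => Real.log ((G n).degree v / n))).abs
          (((hφ.integrable_comp_of_integrable W.integrable_deg).sub
            (integrable_comp_cell P fun v => ((G n).degree v : ℝ) / n)).abs.div_const δ) ?_
        filter_upwards [hφ.quasiMeasurePreserving.ae hW] with x hx
        exact Real.abs_log_sub_log_le hδ hx (hdn _)
    _ ≤ δ * (ε / 2) / δ := by
        rw [integral_div]
        exact div_le_div_of_nonneg_right hle hδ.le
    _ < ε := by
        rw [mul_div_cancel_left₀ _ hδ.ne']
        exact half_lt_self hε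

end Graphon

/-! ### The limit of the number of spanning trees -/

theorem mainTheorem6 {Ω : Type*} [MeasurableSpace Ω] [StandardBorelSpace Ω]
    (μ : Measure Ω) [IsProbabilityMeasure μ] [NullSingletonClass μ] (W : Graphon μ)
    (δ : ℝ) (hδ : 0 < δ)
    (G : (n : ℕ) → SimpleGraph (Fin n)) [∀ n, DecidableRel (G n).Adj]
    (hconn : ∀ᶠ n : ℕ in atTop, (G n).Connected)
    (hdeg : ∀ᶠ n : ℕ in atTop, δ * (n : ℝ) ≤ ((G n).minDegree : ℝ))
    (hconv : Graphon.GraphsConvergeTo G W) :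
    (∀ᵐ x ∂μ, 0 < W.deg x) ∧
    Integrable (fun x => Real.log (W.deg x)) μ ∧
    Tendsto (fun n : ℕ => (numSpanningTrees (G n) : ℝ) ^ (1 / (n : ℝ)) / (n : ℝ)) atTop
      (𝓝 (Real.exp (∫ x, Real.log (W.deg x) ∂μ))) := by
  have hdeg' : ∀ᶠ n : ℕ in atTop, ∀ v, δ * (n : ℝ) ≤ (G n).degree v := by
    filter_upwards [hdeg] with n hn v
    exact hn.trans (Nat.cast_le.2 ((G n).minDegree_le_degree v))
  have hdeg'' : ∀ᶠ n : ℕ in atTop, ∀ v, δ ≤ ((G n).degree v : ℝ) / n := by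
    filter_upwards [hdeg', eventually_gt_atTop 0] with n hn hn0 v
    exact (le_div_iff₀ (Nat.cast_pos.2 hn0)).2 (hn v)
  have hW := hconv.le_deg hdeg''
  refine ⟨hW.mono fun x hx => hδ.trans_le hx, Graphon.integrable_log_deg hδ hW, ?_⟩
  set avg : ℕ → ℝ := fun n => (∑ v, Real.log ((G n).degree v / n)) / n
  have havg : Tendsto avg atTop _ := hconv.tendsto_average_log_degree hδ hdeg''
  have hlog : Tendsto (fun n : ℕ => Real.log n / n) atTop (𝓝 0) :=
    (Real.isLittleO_log_id_atTop.tendsto_div_nhds_zero).comp tendsto_natCast_atTop_atTop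
  -- the first term accounts for the missing degree of the root, the others for the gap between
  -- the number of spanning trees and the product of the degrees
  set err : ℕ → ℝ := fun n =>
    Real.log n / n + ((2 + 4 * Real.log 2) / δ * (1 / n) + 16 / δ * (Real.log n / n))
  have herr : Tendsto err atTop (𝓝 0) := by
    have := hlog.add (((tendsto_one_div_atTop_nhds_zero_nat (𝕜 := ℝ)).const_mul
      ((2 + 4 * Real.log 2) / δ)).add (hlog.const_mul (16 / δ)))
    simpa [err] using this
  have hbounds : ∀ᶠ n : ℕ in atTop,
      (0 : ℝ) < numSpanningTrees (G n) ∧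
      avg n - err n ≤ Real.log (numSpanningTrees (G n)) / n - Real.log n ∧
      Real.log (numSpanningTrees (G n)) / n - Real.log n ≤ avg n := by
    filter_upwards [hconn, hdeg', eventually_gt_atTop 0] with n hc hd hn0
    have hn : (0 : ℝ) < n := Nat.cast_pos.2 hn0
    have hd0 : ∀ v, (0 : ℝ) < (G n).degree v := fun v => (mul_pos hδ hn).trans_le (hd v)
    let r : Fin n := ⟨0, hn0⟩
    have ht : (0 : ℝ) < numSpanningTrees (G n) := Nat.cast_pos.2 hc.numSpanningTrees_pos
    have hlow := hc.le_log_numSpanningTrees r (mul_pos hδ hn) hd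
    have hupp : Real.log (numSpanningTrees (G n))
        ≤ ∑ v ∈ Finset.univ.erase r, Real.log ((G n).degree v) := by
      rw [← Real.log_prod fun v _ => (hd0 v).ne']
      exact Real.log_le_log ht (by exact_mod_cast (G n).numSpanningTrees_le_prod_degree r)
    have hsum := Finset.add_sum_erase Finset.univ (fun v => Real.log ((G n).degree v))
      (Finset.mem_univ r)
    have havg_eq : avg n = (∑ v, Real.log ((G n).degree v)) / n - Real.log n := by
      simp only [avg]
      rw [Finset.sum_congr rfl fun v _ => Real.log_div (hd0 v).ne' hn.ne', Finset.sum_sub_distrib,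
        sub_div]
      simp [hn.ne']
    have hr0 : 0 ≤ Real.log ((G n).degree r) :=
      Real.log_nonneg (Nat.one_le_cast.2 (Nat.cast_pos.1 (hd0 r)))
    have hrn : Real.log ((G n).degree r) ≤ Real.log n := by
      refine Real.log_le_log (hd0 r) (Nat.cast_le.2 ?_)
      simpa using ((G n).degree_lt_card_verts r).le
    rw [Fintype.card_fin, Real.log_mul two_ne_zero (by positivity), Real.log_pow] at hlow
    refine ⟨ht, ?_, ?_⟩
    · have herr_eq : err n = (Real.log n
          + (2 + 4 * (Real.log 2 + (4 : ℕ) * Real.log n)) * (n / (δ * n))) / n := by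
        simp only [err]
        field_simp
        push_cast
        ring
      have : (∑ v, Real.log ((G n).degree v) - (Real.log n
          + (2 + 4 * (Real.log 2 + (4 : ℕ) * Real.log n)) * (n / (δ * n)))) / n
          ≤ Real.log (numSpanningTrees (G n)) / n :=
        div_le_div_of_nonneg_right (by linarith) hn.le
      rw [sub_div] at this
      rw [havg_eq, herr_eq]
      linarith
    · have : Real.log (numSpanningTrees (G n)) / n ≤ (∑ v, Real.log ((G n).degree v)) / n :=
        div_le_div_of_nonneg_right (by linarith) hn.le
      rw [havg_eq]
      linarith
  have hlim : Tendsto (fun n : ℕ => Real.log (numSpanningTrees (G n)) / n - Real.log n) atTop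
      (𝓝 (∫ x, Real.log (W.deg x) ∂μ)) :=
    tendsto_of_tendsto_of_tendsto_of_le_of_le' (by simpa using havg.sub herr) havg
      (hbounds.mono fun n hn => hn.2.1) (hbounds.mono fun n hn => hn.2.2)
  refine ((Real.continuous_exp.tendsto _).comp hlim).congr' ?_
  filter_upwards [hbounds, eventually_gt_atTop 0] with n hn hn0
  rw [Function.comp_apply, Real.exp_sub, Real.exp_log (Nat.cast_pos.2 hn0),
    Real.rpow_def_of_pos hn.1, mul_one_div]
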